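/- Write $\delta_n$ for the unit point mass at $n$ in the complex Banach algebra $\ell_1(\mathbb{Z})$ (with convolution). A shift-invariant predual of $\ell_1(\mathbb{Z})$ is a closed subspace $E\subset\ell_\infty(\mathbb{Z})$, invariant under the bilateral shift, such that the canonical map $\iota_E:\ell_1(\mathbb{Z})\to E^*$, $\langle\iota_E(a),x\rangle=\sum_{n}a(n)x(n)$, is a (not necessarily isometric) isomorphism of Banach spaces; the weak*-topology on $\ell_1(\mathbb{Z})$ is then the one given by its pairing with $E$. A semitopological semigroup compactification of $\mathbb{Z}$ is a compact Hausdorff semigroup $(\mathcal{S},+)$ with separately continuous addition, together with an injective semigroup homomorphism $\mathbb{Z}\to\mathcal{S}$ with dense range. Let $M(\mathcal{S})=C(\mathcal{S})^*$ be the space of complex regular Borel measures on $\mathcal{S}$ with the convolution $\langle\Phi*\Psi,f\rangle=\iint f(s+t)\,d\Phi(s)\,d\Psi(t)$ for $f\in C(\mathcal{S})$, and regard $\ell_1(\mathbb{Z})$ as a subspace of $M(\mathcal{S})$. A pair $(\mathcal{S},\Theta)$ induces $E$ if $\mathcal{S}$ is a semitopological semigroup compactification of $\mathbb{Z}$ and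 $\Theta:M(\mathcal{S})\to\ell_1(\mathbb{Z})$ is a bounded linear projection onto $\ell_1(\mathbb{Z})$ which is a homomorphism for convolution, has weak*-closed kernel, and satisfies $$E=\{f|_{\mathbb{Z}} : f\in C(\mathcal{S}),\ \langle\Psi,f\rangle=0\text{ for all }\Psi\in\ker\Theta\}.$$ Proposition 4.7. Let $E\subset\ell_\infty(\mathbb{Z})$ be a shift-invariant predual of $\ell_1(\mathbb{Z})$. 1. For every $\lambda\in\mathbb{C}$ with $|\lambda|=1$, $\lambda\delta_0$ is not a weak*-limit point of the set $\{\delta_n : n\in\mathbb{Z}\}$; that is, some weak*-neighbourhood of $\lambda\delta_0$ contains no $\delta_n$ different from $\lambda\delta_0$. 2. If the pair $(\mathcal{S},\Theta)$ induces $E$, then $\{0\}$ is open in $\mathcal{S}$, and the homomorphism $\mathbb{Z}\to\mathcal{S}$ is a homeomorphism onto its range (where $\mathbb{Z}$ is discrete). -/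

import Mathlib

open scoped lp ENNReal Topology

noncomputable section

namespace ShiftInvariantPredual

/-! ### The spaces `ℓ¹(ℤ)` and `ℓ^∞(ℤ)`, with complex scalars -/

/-- The point mass `δₙ` in `ℓ¹(ℤ)`. -/
def pointMass (n : ℤ) : ℓ¹(ℤ, ℂ) := lp.single 1 n (1 : ℂ)

/-- The convolution product `(a * b) n = ∑ₖ a k * b (n - k)` of `ℓ¹(ℤ)`. -/
def convolution (a b : ℓ¹(ℤ, ℂ)) : ℓ¹(ℤ, ℂ) :=
  ⟨fun n => ∑' k : ℤ, a k * b (n - k), by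
    have ha : Summable fun k => ‖a k‖ := by simpa using (lp.memℓp a).summable (by simp)
    have hb : Summable fun k => ‖b k‖ := by simpa using (lp.memℓp b).summable (by simp)
    let e : ℤ × ℤ ≃ ℤ × ℤ :=
      { toFun := fun p => (p.2, p.1 - p.2)
        invFun := fun q => (q.2 + q.1, q.1)
        left_inv := fun p => by simp
        right_inv := fun q => by simp }
    have h : Summable fun p : ℤ × ℤ => ‖a p.2 * b (p.1 - p.2)‖ :=
      (e.summable_iff (f := fun q : ℤ × ℤ => ‖a q.1 * b q.2‖)).2 (ha.mul_norm hb)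
    refine memℓp_gen ?_
    simp only [ENNReal.toReal_one, Real.rpow_one]
    exact Summable.of_nonneg_of_le (fun _ => norm_nonneg _)
      (fun n => norm_tsum_le_tsum_norm (h.prod_factor n)) h.prod⟩

/-- The bilateral shift (by `k` places) on `ℓ^∞(ℤ)`: `(shift k x) n = x (n + k)`. -/
def shift (k : ℤ) (x : ℓ^∞(ℤ, ℂ)) : ℓ^∞(ℤ, ℂ) :=
  ⟨fun n => x (n + k), memℓp_infty (by
    obtain ⟨C, hC⟩ := (lp.memℓp x).bddAbove
    refine ⟨C, ?_⟩
    rintro _ ⟨n, rfl⟩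
    exact hC ⟨n + k, rfl⟩)⟩

/-- The canonical embedding of `ℓ¹(ℤ)` in the dual of `ℓ^∞(ℤ)`:
`pairing a x = ∑ₙ a n * x n`. -/
def pairing : ℓ¹(ℤ, ℂ) →L[ℂ] StrongDual ℂ (ℓ^∞(ℤ, ℂ)) :=
  lp.dualPairing 1 ∞ (fun _ => ContinuousLinearMap.mul ℂ ℂ) (K := 1) (fun _ => by simp)

theorem pairing_apply (a : ℓ¹(ℤ, ℂ)) (x : ℓ^∞(ℤ, ℂ)) : pairing a x = ∑' n : ℤ, a n * x n :=
  rfl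

/-! ### Shift-invariant preduals -/

/-- The canonical map `ι_E : ℓ¹(ℤ) → E*`, `⟨ι_E a, x⟩ = ∑ₙ a n * x n`: the embedding of `ℓ¹(ℤ)` in
the dual of `ℓ^∞(ℤ)`, followed by restriction of functionals to `E`. -/
def iota (E : Submodule ℂ (ℓ^∞(ℤ, ℂ))) : ℓ¹(ℤ, ℂ) →L[ℂ] StrongDual ℂ E :=
  (E.subtypeL.precomp ℂ) ∘L pairing

theorem iota_apply (E : Submodule ℂ (ℓ^∞(ℤ, ℂ))) (a : ℓ¹(ℤ, ℂ)) (x : E) :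
    iota E a x = ∑' n : ℤ, a n * (x : ℓ^∞(ℤ, ℂ)) n :=
  rfl

/-- `E ⊆ ℓ^∞(ℤ)` is a shift-invariant (concrete) predual of `ℓ¹(ℤ)`: it is a closed subspace,
`ι_E : ℓ¹(ℤ) → E*` is an isomorphism of Banach spaces (not necessarily isometric), and `E` is
invariant under the bilateral shift. -/
structure IsShiftInvariantPredual (E : Submodule ℂ (ℓ^∞(ℤ, ℂ))) : Prop where
  isClosed : IsClosed (E : Set (ℓ^∞(ℤ, ℂ)))
  isInvertible_iota : (iota E).IsInvertible
  shift_mem : ∀ k : ℤ, ∀ x ∈ E, shift k x ∈ E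

/-- The weak*-topology on `ℓ¹(ℤ)` given by `E`: the coarsest topology for which all the maps
`a ↦ ⟨ι_E a, x⟩`, `x ∈ E`, are continuous. -/
@[reducible]
def weakStarTopology (E : Submodule ℂ (ℓ^∞(ℤ, ℂ))) : TopologicalSpace (ℓ¹(ℤ, ℂ)) :=
  TopologicalSpace.induced (fun (a : ℓ¹(ℤ, ℂ)) (x : E) => iota E a x) Pi.topologicalSpace

/-- `a` is a weak*-limit point (accumulation point) of the set `A`: every weak*-neighbourhood of
`a` contains a point of `A` different from `a`. -/
def IsWeakStarLimitPoint (E : Submodule ℂ (ℓ^∞(ℤ, ℂ))) (a : ℓ¹(ℤ, ℂ)) (A : Set (ℓ¹(ℤ, ℂ))) :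
    Prop :=
  @AccPt _ (weakStarTopology E) a (Filter.principal A)

/-! ### Semigroup compactifications of `ℤ` and the pairs `(S, Θ)` -/

section Compactification

variable {S : Type*} [TopologicalSpace S]

/-- `M(S) = C(S)*`, for a compact Hausdorff space `S`: a complex regular Borel measure `μ` on `S` is
identified with the bounded functional `f ↦ ∫ f dμ`. -/
abbrev BorelMeasures (S : Type*) [TopologicalSpace S] [CompactSpace S] : Type _ :=
  StrongDual ℂ C(S, ℂ)

/-- `φ : ℤ → S` is an injective semigroup homomorphism with dense range. For a compact Hausdorff
semitopological semigroup `S` this says that `S`, with `ℤ` embedded by `φ`, is a semitopological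
semigroup compactification of `ℤ`. -/
structure IsDenseSemigroupEmbedding [Add S] (φ : ℤ → S) : Prop where
  injective : Function.Injective φ
  denseRange : DenseRange φ
  map_add : ∀ m n : ℤ, φ (m + n) = φ m + φ n

/-- The translate `s ↦ f (s + t)` of `f ∈ C(S)`. -/
def translate [Add S] [SeparatelyContinuousAdd S] (f : C(S, ℂ)) (t : S) : C(S, ℂ) :=
  f.comp ⟨fun s => s + t, SeparatelyContinuousAdd.continuous_add_const⟩

variable [CompactSpace S]

/-- `Ξ` is the convolution product of `Φ` and `Ψ` in `M(S)`, that is,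
`⟨Ξ, f⟩ = ∫ (∫ f (s + t) dΦ(s)) dΨ(t)` for all `f ∈ C(S)`. The inner integral
`g t = ⟨Φ, s ↦ f (s + t)⟩` always depends continuously on `t` (a theorem of Grothendieck on
separately continuous functions on compact spaces), so that `⟨Ψ, g⟩` makes sense, and every pair
`Φ`, `Ψ` has exactly one convolution product. -/
def IsConvolution [Add S] [SeparatelyContinuousAdd S] (Φ Ψ Ξ : BorelMeasures S) : Prop :=
  ∀ f : C(S, ℂ), ∃ g : C(S, ℂ), (∀ t : S, g t = Φ (translate f t)) ∧ Ξ f = Ψ g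

/-- Restriction of continuous functions on `S` to `ℤ`: `(restrict φ f) n = f (φ n)`. -/
def restrict (φ : ℤ → S) : C(S, ℂ) →L[ℂ] ℓ^∞(ℤ, ℂ) :=
  LinearMap.mkContinuous
    { toFun := fun f => ⟨fun n => f (φ n), memℓp_infty (by
        refine ⟨‖f‖, ?_⟩
        rintro _ ⟨n, rfl⟩
        exact f.norm_coe_le_norm (φ n))⟩
      map_add' := fun _ _ => rfl
      map_smul' := fun _ _ => rfl } 1 (fun f => by
        rw [one_mul]
        exact lp.norm_le_of_forall_le (norm_nonneg f) fun n => f.norm_coe_le_norm (φ n))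

/-- The canonical map `ℓ¹(ℤ) → M(S)`, `δₙ ↦ δ_{φ n}`; explicitly
`⟨inclusion φ a, f⟩ = ∑ₙ a n * f (φ n)`. -/
def inclusion (φ : ℤ → S) : ℓ¹(ℤ, ℂ) →L[ℂ] BorelMeasures S :=
  ((restrict φ).precomp ℂ) ∘L pairing

theorem inclusion_apply (φ : ℤ → S) (a : ℓ¹(ℤ, ℂ)) (f : C(S, ℂ)) :
    inclusion φ a f = ∑' n : ℤ, a n * f (φ n) :=
  rfl

/-- The pair `(S, Θ)` induces `E`, where the compact semitopological semigroup `S` contains `ℤ` by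
means of `φ`. Here `Θ : M(S) → ℓ¹(ℤ)` is a bounded linear map. -/
structure Induces [Add S] [SeparatelyContinuousAdd S] (φ : ℤ → S)
    (Θ : BorelMeasures S →L[ℂ] ℓ¹(ℤ, ℂ)) (E : Submodule ℂ (ℓ^∞(ℤ, ℂ))) : Prop where
  /-- `S` is a semigroup compactification of `ℤ`. -/
  embedding : IsDenseSemigroupEmbedding φ
  /-- `Θ` is a projection onto `ℓ¹(ℤ) ⊆ M(S)`. -/
  projection : ∀ a : ℓ¹(ℤ, ℂ), Θ (inclusion φ a) = a
  /-- `Θ` is a homomorphism with respect to convolution. -/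
  map_convolution : ∀ Φ Ψ Ξ : BorelMeasures S, IsConvolution Φ Ψ Ξ →
    Θ Ξ = convolution (Θ Φ) (Θ Ψ)
  /-- The kernel of `Θ` is weak*-closed in `M(S) = C(S)*`. -/
  isClosed_ker : IsClosed {Ψ : WeakDual ℂ C(S, ℂ) | Θ (WeakDual.toStrongDual Ψ) = 0}
  /-- `E` is the preannihilator of the kernel of `Θ`, restricted to `ℤ`. -/
  eq_preannihilator : (E : Set (ℓ^∞(ℤ, ℂ))) =
    restrict φ '' {f : C(S, ℂ) | ∀ Ψ : BorelMeasures S, Θ Ψ = 0 → Ψ f = 0}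

end Compactification

end ShiftInvariantPredual

end

/-!
The set `{δₙ}` cannot accumulate weak* at a unimodular multiple `c δ₀` of `δ₀`, because bounded sets
in a separable dual Banach space are weak*-fragmentable: every nonempty bounded set `A` has nonempty
relatively weak*-open subsets of arbitrarily small norm diameter
(`exists_isOpen_inter_dist_le`). This is the Baire category theorem on the weak*-compact closure
of `A`, covered by countably many small norm balls, which are weak*-closed.

Apply this to `A = {u δₙ : ‖u‖ = 1, n ∈ ℤ}` in `E* ≅ ℓ¹(ℤ)`, which is separable. If
`δₘ → c δ₀` along some filter of nonzero `m`, then shift-invariance of `E` gives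
`u c⁻¹ δ_{m + n} → u δₙ`, so that every point of `A` is a weak*-limit of points of `A` at
`ℓ¹`-distance `2` from it. No relatively weak*-open subset of `A` is then small in norm
(`false_of_tendsto_of_le_principal`).

For a pair `(S, Θ)` inducing `E`, every element of `E` is the restriction of a continuous function
on `S`. If `φ 0` were not isolated, density of `φ(ℤ)` would give a filter of nonzero `n` with
`φ n → φ 0`, hence with `δₙ → δ₀` weak*, which was just excluded. Translations then carry the
isolated point `φ 0` to every `φ n`.
-/

namespace ShiftInvariantPredual

open Filter Metric

/-! ### Small relatively weak*-open subsets of bounded sets -/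

/-- A form of the Baire category theorem: if countably many closed sets cover the compact closure
of `A`, one of them contains a nonempty relatively open subset of `A`. -/
theorem exists_isOpen_inter_subset {Y : Type*} [TopologicalSpace Y] [T2Space Y] {A : Set Y}
    (hne : A.Nonempty) (hA : IsCompact (closure A)) {B : ℕ → Set Y} (hB : ∀ j, IsClosed (B j))
    (hcover : closure A ⊆ ⋃ j, B j) :
    ∃ j, ∃ U : Set Y, IsOpen U ∧ (U ∩ A).Nonempty ∧ U ∩ A ⊆ B j := by
  have : CompactSpace (closure A) := isCompact_iff_compactSpace.mp hA
  have : Nonempty (closure A) := hne.closure.to_subtype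
  obtain ⟨j, ⟨z, hz⟩⟩ := nonempty_interior_of_iUnion_of_closed
    (f := fun j => ((↑) : closure A → Y) ⁻¹' B j)
    (fun j => (hB j).preimage continuous_subtype_val)
    (Set.eq_univ_of_forall fun v => by
      obtain ⟨j, hj⟩ := Set.mem_iUnion.1 (hcover v.2)
      exact Set.mem_iUnion.2 ⟨j, hj⟩)
  obtain ⟨U, hU, hUeq⟩ := isOpen_induced_iff.1
    (isOpen_interior (s := ((↑) : closure A → Y) ⁻¹' B j))
  refine ⟨j, U, hU, mem_closure_iff.1 z.2 U hU (hUeq.superset hz), fun v hv => ?_⟩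
  have hmem : (⟨v, subset_closure hv.2⟩ : closure A) ∈ Subtype.val ⁻¹' U := hv.1
  exact interior_subset (s := ((↑) : closure A → Y) ⁻¹' B j) (hUeq.subset hmem)

/-- A nonempty bounded subset of a norm-separable dual space has nonempty relatively weak*-open
subsets of arbitrarily small norm diameter. -/
theorem exists_isOpen_inter_dist_le {X : Type*} [NormedAddCommGroup X] [NormedSpace ℂ X]
    [TopologicalSpace.SeparableSpace (StrongDual ℂ X)] {A : Set (WeakDual ℂ X)}
    (hne : A.Nonempty) {R : ℝ} (hA : ∀ v ∈ A, ‖WeakDual.toStrongDual v‖ ≤ R)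
    {ε : ℝ} (hε : 0 < ε) :
    ∃ U : Set (WeakDual ℂ X), IsOpen U ∧ (U ∩ A).Nonempty ∧ ∀ v ∈ U ∩ A, ∀ w ∈ U ∩ A,
      dist (WeakDual.toStrongDual v) (WeakDual.toStrongDual w) ≤ ε := by
  have hsub : closure A ⊆ WeakDual.toStrongDual ⁻¹' closedBall (0 : StrongDual ℂ X) R :=
    closure_minimal (fun v hv => mem_closedBall_zero_iff.2 (hA v hv))
      (WeakDual.isClosed_closedBall 0 R)
  have hK : IsCompact (closure A) :=
    (WeakDual.isCompact_closedBall (0 : StrongDual ℂ X) R).of_isClosed_subset isClosed_closure hsub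
  obtain ⟨j, U, hU, hne, hball⟩ := exists_isOpen_inter_subset hne hK
    (fun j => WeakDual.isClosed_closedBall (TopologicalSpace.denseSeq (StrongDual ℂ X) j) (ε / 2))
    (fun v _ => by
      obtain ⟨j, hj⟩ := (TopologicalSpace.denseRange_denseSeq (StrongDual ℂ X)).exists_dist_lt
        (WeakDual.toStrongDual v) (half_pos hε)
      exact Set.mem_iUnion.2 ⟨j, hj.le⟩)
  refine ⟨U, hU, hne, fun v hv w hw => ?_⟩
  have hv' := mem_closedBall.1 (Set.mem_preimage.1 (hball hv))
  have hw' := mem_closedBall.1 (Set.mem_preimage.1 (hball hw))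
  exact (dist_triangle_right _ _ _).trans ((add_le_add hv' hw').trans_eq (add_halves ε))

/-! ### Point masses in `ℓ¹(ℤ)` -/

theorem pointMass_apply_self (n : ℤ) : pointMass n n = 1 :=
  lp.single_apply_self (E := fun _ : ℤ => ℂ) 1 n 1

theorem pointMass_apply_of_ne {m n : ℤ} (h : n ≠ m) : pointMass m n = 0 :=
  lp.single_apply_ne (E := fun _ : ℤ => ℂ) 1 m 1 h

theorem iota_pointMass (E : Submodule ℂ (ℓ^∞(ℤ, ℂ))) (n : ℤ) (x : E) :
    iota E (pointMass n) x = (x : ℓ^∞(ℤ, ℂ)) n := by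
  rw [iota_apply, tsum_eq_single n fun m hm => by rw [pointMass_apply_of_ne hm, zero_mul],
    pointMass_apply_self, one_mul]

/-- Distinct point masses with unimodular weights are `ℓ¹`-separated; the bound `1` comes from a
single coordinate (the distance is `2`). -/
theorem one_le_norm_smul_pointMass_sub {m n : ℤ} (h : n ≠ m) (u : ℂ) {w : ℂ} (hw : ‖w‖ = 1) :
    1 ≤ ‖u • pointMass m - w • pointMass n‖ := by
  have := lp.norm_apply_le_norm one_ne_zero (u • pointMass m - w • pointMass n) n
  have hn : (u • pointMass m - w • pointMass n) n = u * pointMass m n - w * pointMass n n := rfl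
  rwa [hn, pointMass_apply_of_ne h, pointMass_apply_self, mul_zero, mul_one, zero_sub, norm_neg,
    hw] at this

/-- `ℓ¹(ℤ)` is the closed linear span of the point masses. -/
theorem separableSpace_lp_one : TopologicalSpace.SeparableSpace (ℓ¹(ℤ, ℂ)) := by
  have hsep : TopologicalSpace.IsSeparable
      (Submodule.span ℂ (Set.range pointMass) : Set (ℓ¹(ℤ, ℂ))) :=
    (Set.countable_range pointMass).isSeparable.span (R := ℂ)
  refine TopologicalSpace.isSeparable_univ_iff.1 (hsep.closure.mono fun a _ => ?_)
  refine mem_closure_of_tendsto (lp.hasSum_single ENNReal.one_ne_top a)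
    (Eventually.of_forall fun s => Submodule.sum_mem _ fun i _ => ?_)
  have : lp.single 1 i (a i) = a i • pointMass i := by
    rw [pointMass, ← lp.single_smul, smul_eq_mul, mul_one]
  rw [this]
  exact Submodule.smul_mem _ _ (Submodule.subset_span ⟨i, rfl⟩)

/-! ### Nonzero integers do not tend weak* to a unimodular multiple of `δ₀` -/

/-- There is no filter of nonzero integers along which `δₙ → c δ₀` weak*, where `‖c‖ = 1`.
Unimodularity of `c` keeps the approximants `u c⁻¹ δ_{m + n}` of `u δₙ` in the bounded set of all
`w δₖ` with `‖w‖ = 1`. -/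
theorem false_of_tendsto_of_le_principal {E : Submodule ℂ (ℓ^∞(ℤ, ℂ))}
    (hE : IsShiftInvariantPredual E) {c : ℂ} (hc : ‖c‖ = 1) {F : Filter ℤ} [F.NeBot]
    (hF : F ≤ 𝓟 {0}ᶜ) (h : ∀ x ∈ E, Tendsto (fun n => x n) F (𝓝 (c * x 0))) : False := by
  obtain ⟨e, he⟩ := hE.isInvertible_iota
  have he' (a : ℓ¹(ℤ, ℂ)) : e a = iota E a := DFunLike.congr_fun he a
  have : TopologicalSpace.SeparableSpace (ℓ¹(ℤ, ℂ)) := separableSpace_lp_one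
  have : TopologicalSpace.SeparableSpace (StrongDual ℂ E) :=
    e.surjective.denseRange.separableSpace e.continuous
  let A : Set (WeakDual ℂ E) :=
    {v | ∃ u : ℂ, ‖u‖ = 1 ∧ ∃ n : ℤ, v = StrongDual.toWeakDual (iota E (u • pointMass n))}
  have hA : ∀ v ∈ A, ‖WeakDual.toStrongDual v‖ ≤ 1 := by
    rintro _ ⟨u, hu, n, rfl⟩
    refine ContinuousLinearMap.opNorm_le_bound _ zero_le_one fun x => ?_
    change ‖iota E (u • pointMass n) x‖ ≤ _
    rw [map_smul, smul_apply, iota_pointMass, norm_smul, hu]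
    gcongr
    exact lp.norm_apply_le_norm ENNReal.top_ne_zero (x : ℓ^∞(ℤ, ℂ)) n
  -- Norm-close functionals on `E` come from elements of `ℓ¹(ℤ)` at distance less than `1`.
  obtain ⟨ε, hε, hsmall⟩ := (Metric.uniformContinuous_iff (f := fun v : StrongDual ℂ E => e.symm v)).1
    e.symm.toContinuousLinearMap.uniformContinuous 1 one_pos
  obtain ⟨U, hU, ⟨v, hvU, hvA⟩, hdist⟩ := exists_isOpen_inter_dist_le (A := A)
    ⟨_, 1, norm_one, 0, rfl⟩ hA (half_pos hε)
  have ⟨u, hu, n, hv⟩ := hvA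
  have hc0 : c ≠ 0 := norm_ne_zero_iff.1 (hc ▸ one_ne_zero)
  have hlim : Tendsto
      (fun m => StrongDual.toWeakDual (iota E ((u * c⁻¹) • pointMass (m + n)))) F (𝓝 v) := by
    rw [tendsto_iff_forall_eval_tendsto_topDualPairing]
    intro x
    have hx := (h _ (hE.shift_mem n x x.2)).const_mul (u * c⁻¹)
    have hval : (topDualPairing ℂ E) v x = u * c⁻¹ * (c * (shift n x : ℓ^∞(ℤ, ℂ)) 0) := by
      have h1 : (topDualPairing ℂ E) v x = u * (x : ℓ^∞(ℤ, ℂ)) n := by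
        rw [hv]
        change iota E (u • pointMass n) x = _
        rw [map_smul, smul_apply, iota_pointMass, smul_eq_mul]
      have h2 : (shift n x : ℓ^∞(ℤ, ℂ)) 0 = (x : ℓ^∞(ℤ, ℂ)) n :=
        congrArg (fun k => (x : ℓ^∞(ℤ, ℂ)) k) (zero_add n)
      rw [h1, h2]
      field_simp
    rw [hval]
    refine hx.congr fun m => ?_
    change _ = iota E ((u * c⁻¹) • pointMass (m + n)) x
    rw [map_smul, smul_apply, iota_pointMass, smul_eq_mul]
    rfl
  obtain ⟨m, hmU, hm0⟩ := ((hlim.eventually (hU.mem_nhds hvU)).and (le_principal_iff.1 hF)).exists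
  have hd := hdist _ ⟨hmU, u * c⁻¹, by simp [hu, hc], m + n, rfl⟩ v ⟨hvU, hvA⟩
  rw [hv] at hd
  have hone := hsmall (hd.trans_lt (half_lt_self hε))
  change dist (e.symm (iota E _)) (e.symm (iota E _)) < 1 at hone
  rw [← he', ← he', e.symm_apply_apply, e.symm_apply_apply, dist_eq_norm] at hone
  refine hone.not_ge (one_le_norm_smul_pointMass_sub (fun hn => hm0 ?_) _ hu)
  exact Set.mem_singleton_iff.2 (by omega)

theorem not_isWeakStarLimitPoint {E : Submodule ℂ (ℓ^∞(ℤ, ℂ))}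
    (hE : IsShiftInvariantPredual E) {c : ℂ} (hc : ‖c‖ = 1) :
    ¬ IsWeakStarLimitPoint E (c • pointMass 0) (Set.range pointMass) := by
  intro hacc
  let j : ℓ¹(ℤ, ℂ) → E → ℂ := fun a x => iota E a x
  have hinj : Function.Injective j := fun a b hab => by
    obtain ⟨e, he⟩ := hE.isInvertible_iota
    have he' (a : ℓ¹(ℤ, ℂ)) : e a = iota E a := DFunLike.congr_fun he a
    refine e.injective ?_
    rw [he', he']
    exact ContinuousLinearMap.ext fun x => congrFun hab x
  let τ : TopologicalSpace (ℓ¹(ℤ, ℂ)) := weakStarTopology E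
  have hj : Continuous[τ, _] j := continuous_induced_dom
  have hfreq : ∃ᶠ b in @nhds _ τ (c • pointMass 0), b ≠ pointMass 0 ∧ b ∈ Set.range pointMass := by
    have hfr := (@accPt_iff_frequently _ τ _ _).1 hacc
    by_cases h : pointMass 0 = c • pointMass 0
    · rwa [← h] at hfr ⊢
    · -- Here `δ₀` itself lies outside some neighbourhood of `c δ₀`.
      have hev : ∀ᶠ b in @nhds _ τ (c • pointMass 0), b ≠ pointMass 0 :=
        ((@Continuous.tendsto _ _ τ _ _ hj (c • pointMass 0)).eventually
          (isOpen_compl_singleton.mem_nhds (hinj.ne (Ne.symm h)))).mono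
          fun b hb hb0 => hb (congrArg j hb0)
      exact (hfr.and_eventually hev).mono fun b hb => ⟨hb.2, hb.1.2⟩
  let F : Filter ℤ := comap pointMass (@nhds _ τ (c • pointMass 0)) ⊓ 𝓟 {0}ᶜ
  have : F.NeBot := by
    rw [inf_principal_neBot_iff]
    rintro V ⟨W, hW, hWV⟩
    obtain ⟨_, ⟨hne, n, rfl⟩, hn⟩ := (hfreq.and_eventually hW).exists
    exact ⟨n, hWV hn, fun h0 => hne (congrArg pointMass h0)⟩
  refine false_of_tendsto_of_le_principal hE hc (F := F) inf_le_right fun x hx => ?_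
  have hcont : Continuous[τ, _] fun a => iota E a ⟨x, hx⟩ :=
    (continuous_apply (⟨x, hx⟩ : E)).comp hj
  have ht := (@Continuous.tendsto _ _ τ _ _ hcont (c • pointMass 0)).comp
    ((tendsto_comap (f := pointMass)).mono_left (inf_le_left (b := 𝓟 {0}ᶜ)))
  rw [map_smul, smul_apply, iota_pointMass, smul_eq_mul] at ht
  exact ht.congr fun n => iota_pointMass E n ⟨x, hx⟩

/-! ### Compactifications inducing a predual -/

section Compactification

variable {S : Type*} [TopologicalSpace S] [CompactSpace S] [T2Space S] [AddSemigroup S]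
  [SeparatelyContinuousAdd S] {φ : ℤ → S} {Θ : BorelMeasures S →L[ℂ] ℓ¹(ℤ, ℂ)}
  {E : Submodule ℂ (ℓ^∞(ℤ, ℂ))}

theorem Induces.isOpen_singleton_zero (h : Induces φ Θ E) (hE : IsShiftInvariantPredual E) :
    IsOpen ({φ 0} : Set S) := by
  by_contra hopen
  have hne : (𝓝[≠] φ 0).NeBot := by
    rwa [neBot_iff, Ne, ← isOpen_singleton_iff_punctured_nhds]
  have : (comap φ (𝓝[≠] φ 0)).NeBot := by
    refine comap_neBot fun V hV => ?_
    obtain ⟨W, hW, hW0, hWV⟩ := mem_nhdsWithin.1 hV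
    obtain ⟨s, hs⟩ := hne.nonempty_of_mem
      (inter_mem_nhdsWithin {φ 0}ᶜ (hW.mem_nhds hW0))
    obtain ⟨n, hn⟩ := h.embedding.denseRange.exists_mem_open
      (hW.inter (isOpen_compl_singleton (x := φ 0))) ⟨s, hs.2, hs.1⟩
    exact ⟨n, hWV hn⟩
  refine false_of_tendsto_of_le_principal hE norm_one (F := comap φ (𝓝[≠] φ 0))
    (le_principal_iff.2 ⟨{φ 0}ᶜ, self_mem_nhdsWithin, fun n hn h0 => hn (congrArg φ h0)⟩)
    fun x hx => ?_
  obtain ⟨f, -, rfl⟩ := h.eq_preannihilator.subset hx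
  rw [one_mul]
  exact (f.continuous.tendsto (φ 0)).comp (tendsto_comap.mono_right nhdsWithin_le_nhds)

theorem Induces.isEmbedding (h : Induces φ Θ E) (hE : IsShiftInvariantPredual E) :
    Topology.IsEmbedding φ := by
  refine ⟨⟨?_⟩, h.embedding.injective⟩
  refine (eq_bot_of_singletons_open (t := .induced φ _) fun n => ?_).symm
  -- `φ n` is isolated by the preimage of `{φ 0}` under translation by `φ (-n)`.
  refine ⟨(fun s => s + φ (-n)) ⁻¹' {φ 0}, (h.isOpen_singleton_zero hE).preimage
    SeparatelyContinuousAdd.continuous_add_const, ?_⟩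
  ext m
  simp only [Set.mem_preimage, Set.mem_singleton_iff, ← h.embedding.map_add,
    h.embedding.injective.eq_iff]
  omega

end Compactification

end ShiftInvariantPredual

theorem proposition4p7 (E : Submodule ℂ (ℓ^∞(ℤ, ℂ)))
    (hE : ShiftInvariantPredual.IsShiftInvariantPredual E) :
    (∀ c : ℂ, ‖c‖ = 1 →
      ¬ ShiftInvariantPredual.IsWeakStarLimitPoint E (c • ShiftInvariantPredual.pointMass 0)
        (Set.range ShiftInvariantPredual.pointMass)) ∧
    (∀ (S : Type*) [TopologicalSpace S] [CompactSpace S] [T2Space S] [AddSemigroup S]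
      [SeparatelyContinuousAdd S] (φ : ℤ → S)
      (Θ : ShiftInvariantPredual.BorelMeasures S →L[ℂ] ℓ¹(ℤ, ℂ)),
      ShiftInvariantPredual.Induces φ Θ E →
        IsOpen ({φ 0} : Set S) ∧ Topology.IsEmbedding φ) :=
  ⟨fun _ hc => ShiftInvariantPredual.not_isWeakStarLimitPoint hE hc,
    fun _ _ _ _ _ _ _ _ h => ⟨h.isOpen_singleton_zero hE, h.isEmbedding hE⟩⟩
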